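/- Let $\mathbb I=[0,1]$ with its usual topology. The split interval is $\ddot{\mathbb I}=[0,1]\times\{0,1\}$ with the topology generated by the lexicographic order ($\langle x,i\rangle\le\langle y,j\rangle$ iff $x<y$, or $x=y$ and $i\le j$). Let $p:\ddot{\mathbb I}\to\mathbb I$, $p(\langle x,i\rangle)=x$, let the squares $\mathbb I^2$ and $\ddot{\mathbb I}^2$ carry the product topologies, and let $P:\ddot{\mathbb I}^2\to\mathbb I^2$, $P(\langle a,b\rangle)=\langle p(a),p(b)\rangle$. Consider the multimap $P^{-1}$ that assigns to each $z\in\mathbb I^2$ the set $P^{-1}(z)\subset\ddot{\mathbb I}^2$. This multimap is usco: each set $P^{-1}(z)$ is compact and non-empty, and for every closed $F\subset\ddot{\mathbb I}^2$ the set $\{z\in\mathbb I^2: P^{-1}(z)\cap F\neq\emptyset\}$ is closed in $\mathbb I^2$. Call a function $s:\mathbb I^2\to\ddot{\mathbb I}^2$ a selection of $P^{-1}$ if $s(z)\in P^{-1}(z)$ for all $z\in\mathbb I^2$; call $s$ Borel-measurable (resp. $F_\sigma$-measurable) if for every open $U\subset\ddot{\mathbb I}^2$ the set $s^{-1}[U]$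 is Borel (resp. a countable union of closed sets) in $\mathbb I^2$. Then the following conditions are equivalent: 1. $P^{-1}$ has a Borel-measurable selection; 2. $P^{-1}$ has an $F_\sigma$-measurable selection; 3. $\omega_1=\mathfrak c$ (the Continuum Hypothesis). -/

import Mathlib

/-- The split interval `[0,1] × {0,1}`, carrying the lexicographic order. -/
def SplitInterval : Type := unitInterval ×ₗ Fin 2

namespace SplitInterval

noncomputable instance : LinearOrder SplitInterval :=
  inferInstanceAs (LinearOrder (unitInterval ×ₗ Fin 2))

/-- The topology generated by the open rays of the lexicographic order. -/
noncomputable instance : TopologicalSpace SplitInterval := Preorder.topology SplitInterval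

instance : OrderTopology SplitInterval := ⟨rfl⟩

/-- The point `⟨x, i⟩` of the split interval. -/
def mk (x : unitInterval) (i : Fin 2) : SplitInterval := toLex (x, i)

/-- The natural projection `p : ⟨x, i⟩ ↦ x` onto the unit interval. -/
def proj (a : SplitInterval) : unitInterval :=
  (ofLex (show unitInterval ×ₗ Fin 2 from a)).1

/-- The projection `P : ⟨a, b⟩ ↦ ⟨p a, p b⟩` of the split square onto the unit square.
Both squares carry the product topology. -/
def projSq (z : SplitInterval × SplitInterval) : unitInterval × unitInterval :=
  (proj z.1, proj z.2)

/-- The multimap `P⁻¹` from the unit square to the split square: the inverse of the relation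
`{⟨z, P z⟩}`. -/
def projSqInv : SetRel (unitInterval × unitInterval) (SplitInterval × SplitInterval) :=
  (Function.graph projSq).inv

end SplitInterval

/-- `f` is a selection of the multimap `Φ`. -/
def IsSelection {X Y : Type*} (f : X → Y) (Φ : SetRel X Y) : Prop :=
  ∀ x : X, (x, f x) ∈ Φ

section Multimap

variable {X Y : Type*} [TopologicalSpace X] [TopologicalSpace Y]

/-- A multimap `Φ`, given as a subset of `X × Y`, is usco if it is upper semicontinuous (the set
of all `x` with `Φ x ∩ F ≠ ∅` is closed for every closed `F`) and all its values are compact and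
non-empty. -/
structure IsUsco (Φ : SetRel X Y) : Prop where
  upperSemicontinuous : ∀ F : Set Y, IsClosed F → IsClosed (Φ.inv.image F)
  isCompact_value : ∀ x : X, IsCompact {y : Y | (x, y) ∈ Φ}
  nonempty_value : ∀ x : X, {y : Y | (x, y) ∈ Φ}.Nonempty

/-- A set of type `F_σ`: a countable union of closed sets. -/
def IsFsigma (S : Set X) : Prop :=
  ∃ F : ℕ → Set X, (∀ n, IsClosed (F n)) ∧ S = ⋃ n, F n

/-- Preimages of open sets are Borel, i.e. belong to the σ-algebra generated by the open sets. -/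
def IsBorelMeasurable (f : X → Y) : Prop :=
  ∀ U : Set Y, IsOpen U → @MeasurableSet X (borel X) (f ⁻¹' U)

/-- Preimages of open sets are of type `F_σ`. -/
def IsFsigmaMeasurable (f : X → Y) : Prop :=
  ∀ U : Set Y, IsOpen U → IsFsigma (f ⁻¹' U)

end Multimap

open Set Filter Topology Cardinal

/-! A selection gives each point of the square a type `(i, j)`, the sides it picks in the two
coordinates. Near a point of that type, an open set of the split square contains all fibres over a
small open quadrant in direction `(i, j)`.

Borel implies CH: on a curve that never enters the `(i, j)` quadrants of its own points, unions of
open quadrants of the split square cut out every subset of the points of type `(i, j)`, so these are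
countable (`countable_setOf_side_eq`). Hence lines of slope -1 carry countably many points with
equal sides, lines of slope 1 countably many with different sides, and Sierpiński's criterion
applies.

CH implies `F_σ`: the non-interior part of a preimage of an open set splits, by type and rational
corner, into countably many quadrant-free pieces. Each lies on a strictly monotone curve, up to
countably many axis-parallel lines (`QuadrantFree.exists_codedCurve`). There are only `ℵ₁` such
curves, so `exists_coloring` can choose sides for which each curve has countably many points of the
bad type. It also makes one of the two sides equal to `1` off a finite set on every axis-parallel
line, where the problem becomes one-dimensional. -/

/-- The order `<` for `i = 1`, the order `>` for `i = 0`. -/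
def SideLT {α : Type*} [LT α] (i : Fin 2) (a b : α) : Prop :=
  if i = 0 then b < a else a < b

section SideLT

variable {α : Type*} [LinearOrder α] {a b c : α}

lemma sideLT_zero : SideLT 0 a b ↔ b < a := by simp [SideLT]

lemma sideLT_one : SideLT 1 a b ↔ a < b := by simp [SideLT]

lemma SideLT.trans {i : Fin 2} (h : SideLT i a b) (h' : SideLT i b c) : SideLT i a c := by
  fin_cases i <;> simp only [SideLT, Fin.zero_eta, Fin.mk_one, if_true, one_ne_zero, if_false] at *
  · exact h'.trans h
  · exact h.trans h'

lemma sideLT_or_sideLT_of_ne (i : Fin 2) (h : a ≠ b) : SideLT i a b ∨ SideLT i b a := by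
  fin_cases i
  · simpa [SideLT] using h.symm.lt_or_gt
  · simpa [SideLT] using h.lt_or_gt

lemma exists_rat_sideLT (i : Fin 2) {a b : ℝ} (h : SideLT i a b) :
    ∃ q : ℚ, SideLT i a q ∧ SideLT i (q : ℝ) b := by
  fin_cases i
  · obtain ⟨q, h₁, h₂⟩ := exists_rat_btwn (sideLT_zero.1 h)
    exact ⟨q, sideLT_zero.2 h₂, sideLT_zero.2 h₁⟩
  · obtain ⟨q, h₁, h₂⟩ := exists_rat_btwn (sideLT_one.1 h)
    exact ⟨q, sideLT_one.2 h₁, sideLT_one.2 h₂⟩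

lemma isOpen_setOf_sideLT {X : Type*} [TopologicalSpace X] (i : Fin 2) {f g : X → ℝ}
    (hf : Continuous f) (hg : Continuous g) : IsOpen {x | SideLT i (f x) (g x)} := by
  fin_cases i
  · simpa [SideLT] using isOpen_lt hg hf
  · simpa [SideLT] using isOpen_lt hf hg

end SideLT

/-! ### Order, topology and compactness of the split interval -/

namespace SplitInterval

/-- The second coordinate of a point of the split interval. -/
def side (a : SplitInterval) : Fin 2 :=
  (ofLex (show unitInterval ×ₗ Fin 2 from a)).2

lemma mk_proj_side (a : SplitInterval) : mk (proj a) (side a) = a := rfl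

lemma mk_lt_mk {x y : unitInterval} {i j : Fin 2} :
    mk x i < mk y j ↔ x < y ∨ x = y ∧ i < j :=
  Prod.Lex.toLex_lt_toLex

lemma mk_le_mk {x y : unitInterval} {i j : Fin 2} :
    mk x i ≤ mk y j ↔ x < y ∨ x = y ∧ i ≤ j :=
  Prod.Lex.toLex_le_toLex

lemma monotone_proj : Monotone proj := by
  intro a b h
  rw [← mk_proj_side a, ← mk_proj_side b, mk_le_mk] at h
  rcases h with h | h
  exacts [h.le, h.1.le]

lemma mk_lt_of_lt_proj {x : unitInterval} {a : SplitInterval} (i : Fin 2) (h : x < proj a) :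
    mk x i < a := by
  rw [← mk_proj_side a, mk_lt_mk]
  exact Or.inl h

lemma lt_mk_of_proj_lt {x : unitInterval} {a : SplitInterval} (i : Fin 2) (h : proj a < x) :
    a < mk x i := by
  rw [← mk_proj_side a, mk_lt_mk]
  exact Or.inl h

lemma mk_one_lt_iff {x : unitInterval} {a : SplitInterval} : mk x 1 < a ↔ x < proj a := by
  refine ⟨fun h ↦ ?_, mk_lt_of_lt_proj 1⟩
  rw [← mk_proj_side a, mk_lt_mk] at h
  rcases h with h | h
  · exact h
  · exact absurd h.2 (by have := (side a).isLt; omega)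

lemma lt_mk_zero_iff {x : unitInterval} {a : SplitInterval} : a < mk x 0 ↔ proj a < x := by
  refine ⟨fun h ↦ ?_, lt_mk_of_proj_lt 0⟩
  rw [← mk_proj_side a, mk_lt_mk] at h
  rcases h with h | h
  · exact h
  · exact absurd h.2 (by simp)

lemma continuous_proj : Continuous proj := by
  rw [continuous_iff_continuousAt]
  intro a
  rw [ContinuousAt, tendsto_order]
  constructor
  · intro x hx
    filter_upwards [lt_mem_nhds (mk_lt_of_lt_proj 1 hx)] with b hb using mk_one_lt_iff.1 hb
  · intro x hx
    filter_upwards [gt_mem_nhds (lt_mk_of_proj_lt 0 hx)] with b hb using lt_mk_zero_iff.1 hb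

lemma lt_mk_one_iff {x : unitInterval} {a : SplitInterval} : a < mk x 1 ↔ a ≤ mk x 0 := by
  rw [← mk_proj_side a, mk_le_mk, mk_lt_mk]
  have := (side a).isLt
  refine or_congr_right (and_congr_right fun _ ↦ ?_)
  omega

lemma mk_zero_lt_iff {x : unitInterval} {a : SplitInterval} : mk x 0 < a ↔ mk x 1 ≤ a := by
  rw [← not_le, ← lt_mk_one_iff, not_lt]

/-- An ultrafilter projects to one converging to some `x`; it converges to `⟨x, 0⟩` or `⟨x, 1⟩`
according to which half of the split at `x` it contains. -/
instance : CompactSpace SplitInterval := by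
  refine ⟨isCompact_iff_ultrafilter_le_nhds.2 fun F _ ↦ ?_⟩
  obtain ⟨x, -, hx⟩ := isCompact_iff_ultrafilter_le_nhds.1 (isCompact_univ (X := unitInterval))
    (F.map proj) (by simp)
  have hx : Tendsto proj F (𝓝 x) := hx
  rw [tendsto_order] at hx
  rcases Ultrafilter.em F (fun a ↦ a ≤ mk x 0) with h | h
  · refine ⟨mk x 0, mem_univ _, ?_⟩
    change Tendsto id (F : Filter SplitInterval) _
    refine tendsto_order.2 ⟨fun a ha ↦ ?_, fun a ha ↦ ?_⟩
    · filter_upwards [hx.1 _ (lt_mk_zero_iff.1 ha)] with b hb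
      exact lt_of_not_ge fun hba ↦ (monotone_proj hba).not_gt hb
    · filter_upwards [h] with b hb using hb.trans_lt ha
  · refine ⟨mk x 1, mem_univ _, ?_⟩
    change Tendsto id (F : Filter SplitInterval) _
    refine tendsto_order.2 ⟨fun a ha ↦ ?_, fun a ha ↦ ?_⟩
    · filter_upwards [h] with b hb
      exact ha.trans_le (mk_zero_lt_iff.1 (not_le.1 hb))
    · filter_upwards [hx.2 _ (mk_one_lt_iff.1 ha)] with b hb
      exact lt_of_not_ge fun hba ↦ (monotone_proj hba).not_gt hb

lemma continuous_projSq : Continuous projSq :=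
  (continuous_proj.comp continuous_fst).prodMk (continuous_proj.comp continuous_snd)

theorem isUsco_projSqInv : IsUsco projSqInv where
  upperSemicontinuous F hF := by
    have : projSqInv.inv.image F = projSq '' F := by
      ext z
      rfl
    rw [this]
    exact (hF.isCompact.image continuous_projSq).isClosed
  isCompact_value z := by
    have : {w | (z, w) ∈ projSqInv} = projSq ⁻¹' {z} := rfl
    rw [this]
    exact (isClosed_singleton.preimage continuous_projSq).isCompact
  nonempty_value z := ⟨(mk z.1 0, mk z.2 0), rfl⟩

/-- A neighbourhood of `⟨x, i⟩` contains the fibres of all points close to `x` on the side `i`. -/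
lemma exists_rat_forall_mk_mem {V : Set SplitInterval} (hV : IsOpen V) {x : unitInterval}
    {i : Fin 2} (h : mk x i ∈ V) :
    ∃ c : ℚ, SideLT i (x : ℝ) c ∧
      ∀ w : unitInterval, SideLT i (x : ℝ) w → SideLT i (w : ℝ) c → ∀ j, mk w j ∈ V := by
  fin_cases i
  · simp only [SideLT, Fin.zero_eta, if_true] at *
    by_cases hx : ∃ l, l < mk x 0
    · obtain ⟨l, hl, hlV⟩ := exists_Ioc_subset_of_mem_nhds (hV.mem_nhds h) hx
      obtain ⟨c, hc, hcx⟩ := exists_rat_btwn (Subtype.coe_lt_coe.2 (lt_mk_zero_iff.1 hl))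
      refine ⟨c, hcx, fun w hw hcw j ↦ hlV ⟨?_, ?_⟩⟩
      · rw [← mk_proj_side l, mk_lt_mk]
        exact Or.inl (Subtype.coe_lt_coe.1 (hc.trans hcw))
      · exact mk_le_mk.2 (Or.inl (Subtype.coe_lt_coe.1 hw))
    -- Here `x` is the left endpoint and nothing lies on its side `0`, so any rational below `0`
    -- serves.
    · refine ⟨-1, by push_cast; linarith [x.2.1], fun w hw _ j ↦ absurd ⟨mk w 0, ?_⟩ hx⟩
      exact mk_lt_mk.2 (Or.inl (Subtype.coe_lt_coe.1 hw))
  · simp only [SideLT, Fin.mk_one, one_ne_zero, if_false] at *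
    by_cases hx : ∃ l, mk x 1 < l
    · obtain ⟨l, hl, hlV⟩ := exists_Ico_subset_of_mem_nhds (hV.mem_nhds h) hx
      obtain ⟨c, hxc, hc⟩ := exists_rat_btwn (Subtype.coe_lt_coe.2 (mk_one_lt_iff.1 hl))
      refine ⟨c, hxc, fun w hw hcw j ↦ hlV ⟨?_, ?_⟩⟩
      · exact mk_le_mk.2 (Or.inl (Subtype.coe_lt_coe.1 hw))
      · rw [← mk_proj_side l, mk_lt_mk]
        exact Or.inl (Subtype.coe_lt_coe.1 (hcw.trans hc))
    · refine ⟨2, by push_cast; linarith [x.2.2], fun w hw _ j ↦ absurd ⟨mk w 0, ?_⟩ hx⟩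
      exact mk_lt_mk.2 (Or.inl (Subtype.coe_lt_coe.1 hw))

end SplitInterval

/-! ### Two cardinality criteria -/

/-- A set all of whose subsets are Borel is countable. -/
theorem Set.countable_of_forall_subset_measurableSet {X : Type*} [MeasurableSpace X]
    [StandardBorelSpace X] {B : Set X} (h : ∀ A ⊆ B, MeasurableSet A) : B.Countable := by
  by_contra hB
  have := (h B subset_rfl).standardBorel
  have hR : ¬ Countable ℝ := by
    rw [← not_uncountable_iff, not_not]
    infer_instance
  -- An uncountable `B` would be Borel isomorphic to `ℝ`, making all `2 ^ 𝔠` subsets of `ℝ` Borel,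
  -- but only `𝔠` sets are.
  let e : B ≃ᵐ ℝ := PolishSpace.measurableEquivOfNotCountable (fun hc ↦ hB hc) hR
  have hall : ∀ T : Set ℝ, MeasurableSet T := by
    intro T
    rw [← e.measurableSet_preimage]
    have hT := measurable_subtype_coe (p := (· ∈ B))
      (h (Subtype.val '' (e ⁻¹' T)) (Subtype.coe_image_subset _ _))
    rwa [preimage_image_eq _ Subtype.val_injective] at hT
  have hcard := MeasurableSpace.cardinal_measurableSet_le_continuum
    (s := MeasurableSpace.countableGeneratingSet ℝ)
    ((MeasurableSpace.countable_countableGeneratingSet (α := ℝ)).le_aleph0.trans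
      aleph0_le_continuum)
  rw [MeasurableSpace.generateFrom_countableGeneratingSet] at hcard
  simp only [hall, ofPred_true, mk_univ, mk_set, mk_real] at hcard
  exact (cantor 𝔠).not_ge hcard

/-- Sierpiński's criterion: a plane that splits into a set with countable vertical sections and
a set with countable horizontal sections has cardinality at most `ℵ₁`. -/
theorem Cardinal.mk_le_aleph_one_of_countable_sections {X : Type*} {E : Set (X × X)}
    (hE : ∀ u, {v | (u, v) ∈ E}.Countable) (hE' : ∀ v, {u | (u, v) ∉ E}.Countable) :
    #X ≤ ℵ₁ := by
  by_contra! h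
  obtain ⟨T, hT⟩ := le_mk_iff_exists_set.1 h.le
  -- The sections over `ℵ₁` many points cannot cover `X`; a missed `v` has all of `T` in its
  -- complementary section.
  have hlt : #(⋃ u ∈ T, {v | (u, v) ∈ E} : Set X) < #X := by
    refine lt_of_le_of_lt ((mk_biUnion_le _ _).trans ?_) h
    rw [hT]
    have hsup : ⨆ u : T, #{v | (u.1, v) ∈ E} ≤ ℵ₀ := ciSup_le' fun u ↦ (hE u.1).le_aleph0
    calc ℵ₁ * ⨆ u : T, #{v | (u.1, v) ∈ E} ≤ ℵ₁ * ℵ₀ := by gcongr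
      _ = ℵ₁ := mul_aleph0_eq aleph0_lt_aleph_one.le
  obtain ⟨v, hv⟩ : ∃ v, v ∉ ⋃ u ∈ T, {v | (u, v) ∈ E} := by
    by_contra! hall
    rw [eq_univ_of_forall hall, mk_univ] at hlt
    exact hlt.false
  have hTc : T.Countable := (hE' v).mono fun u hu huv ↦ hv (mem_biUnion hu huv)
  rw [← le_aleph0_iff_set_countable, hT] at hTc
  exact aleph0_lt_aleph_one.not_ge hTc

/-! ### A Borel selection yields CH -/

namespace SplitInterval

/-- The closed ray that starts at `⟨x, i⟩` and goes to the side `i`. -/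
def ray (x : unitInterval) (i : Fin 2) : Set SplitInterval :=
  if i = 0 then Iic (mk x 0) else Ici (mk x 1)

lemma isOpen_ray (x : unitInterval) (i : Fin 2) : IsOpen (ray x i) := by
  unfold ray
  split_ifs
  · convert isOpen_Iio (a := mk x 1) using 1
    ext a
    exact lt_mk_one_iff.symm
  · convert isOpen_Ioi (a := mk x 0) using 1
    ext a
    exact mk_zero_lt_iff.symm

lemma not_sideLT_of_mk_mem_ray {x y : unitInterval} {i k : Fin 2} (h : mk y k ∈ ray x i) :
    ¬ SideLT i y x := by
  unfold ray at h
  unfold SideLT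
  split_ifs at h ⊢
  exacts [(monotone_proj h).not_gt, (monotone_proj h).not_gt]

lemma mk_mem_ray_iff {x : unitInterval} {i k : Fin 2} : mk x k ∈ ray x i ↔ k = i := by
  unfold ray
  split_ifs with hi
  · simp [mk_le_mk, hi]
  · simp only [mem_Ici, mk_le_mk, lt_self_iff_false, true_and, false_or]
    have := k.isLt
    omega

variable {s : unitInterval × unitInterval → SplitInterval × SplitInterval}

lemma selection_apply (hs : IsSelection s projSqInv) (z : unitInterval × unitInterval) :
    s z = (mk z.1 (side (s z).1), mk z.2 (side (s z).2)) := by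
  have h : projSq (s z) = z := hs z
  have h₁ : proj (s z).1 = z.1 := congrArg Prod.fst h
  have h₂ : proj (s z).2 = z.2 := congrArg Prod.snd h
  rw [← h₁, ← h₂, mk_proj_side, mk_proj_side]

/-- On a curve that moves in no direction of the quadrant `(i, j)`, a Borel selection takes values
of type `(i, j)` only countably often. -/
lemma countable_setOf_side_eq (hs : IsSelection s projSqInv) (hb : IsBorelMeasurable s)
    {γ : unitInterval → unitInterval × unitInterval} (hγ : Continuous γ) {i j : Fin 2}
    (hij : ∀ t t', ¬ SideLT i (γ t).1 (γ t').1 → ¬ SideLT j (γ t).2 (γ t').2 → t = t') :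
    {t | side (s (γ t)).1 = i ∧ side (s (γ t)).2 = j}.Countable := by
  refine countable_of_forall_subset_measurableSet fun A hA ↦ ?_
  -- This set is open for an arbitrary `A`, and its preimage along `γ` is exactly `A`: by `hij`, the
  -- rectangle at `γ t` catches no other point of the curve.
  have hU : IsOpen (⋃ t ∈ A, ray (γ t).1 i ×ˢ ray (γ t).2 j) :=
    isOpen_biUnion fun t _ ↦ (isOpen_ray _ _).prod (isOpen_ray _ _)
  have hγ' : @Measurable _ _ (borel unitInterval) (borel (unitInterval × unitInterval)) γ :=
    hγ.borel_measurable
  have hm := hγ' (hb _ hU)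
  rw [← BorelSpace.measurable_eq (α := unitInterval)] at hm
  convert hm using 1
  ext t
  simp only [mem_preimage, mem_iUnion, exists_prop]
  constructor
  · intro ht
    refine ⟨t, ht, ?_⟩
    rw [selection_apply hs]
    exact ⟨mk_mem_ray_iff.2 (hA ht).1, mk_mem_ray_iff.2 (hA ht).2⟩
  · rintro ⟨t', ht', h⟩
    rw [selection_apply hs] at h
    rwa [hij t t' (not_sideLT_of_mk_mem_ray h.1) (not_sideLT_of_mk_mem_ray h.2)]

/-- The midpoint of two points of the unit interval. -/
noncomputable def midpoint (u v : unitInterval) : unitInterval :=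
  ⟨((u : ℝ) + v) / 2, by linarith [u.2.1, v.2.1], by linarith [u.2.2, v.2.2]⟩

lemma continuous_midpoint :
    Continuous fun z : unitInterval × unitInterval ↦ midpoint z.1 z.2 := by
  unfold midpoint
  fun_prop

/-- Coordinates on the unit square whose axes are the two diagonal directions. -/
noncomputable def diag (u v : unitInterval) : unitInterval × unitInterval :=
  (midpoint u v, midpoint u (unitInterval.symm v))

lemma continuous_diag : Continuous fun z : unitInterval × unitInterval ↦ diag z.1 z.2 :=
  continuous_midpoint.prodMk
    (continuous_midpoint.comp
      (continuous_fst.prodMk (unitInterval.continuous_symm.comp continuous_snd)))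

lemma diag_fst_lt_iff {u v u' v' : unitInterval} :
    (diag u v).1 < (diag u' v').1 ↔ (u : ℝ) + v < u' + v' := by
  rw [← Subtype.coe_lt_coe]
  exact div_lt_div_iff_of_pos_right two_pos

lemma diag_snd_lt_iff {u v u' v' : unitInterval} :
    (diag u v).2 < (diag u' v').2 ↔ (u : ℝ) - v < u' - v' := by
  rw [← Subtype.coe_lt_coe]
  simp only [diag, midpoint, unitInterval.coe_symm_eq]
  constructor <;> intro h <;> linarith

theorem aleph_one_eq_continuum_of_borel_selection (hs : IsSelection s projSqInv)
    (hb : IsBorelMeasurable s) : aleph.{0} 1 = continuum.{0} := by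
  refine le_antisymm aleph_one_le_continuum ?_
  have hc (i j : Fin 2) (γ : unitInterval → unitInterval × unitInterval) (hγ : Continuous γ)
      (h : ∀ t t', ¬ SideLT i (γ t).1 (γ t').1 → ¬ SideLT j (γ t).2 (γ t').2 → t = t') :=
    countable_setOf_side_eq hs hb hγ h
  have h2 : ∀ i : Fin 2, i = 0 ∨ i = 1 := by decide
  have hX : #unitInterval ≤ aleph.{0} 1 := by
    refine mk_le_aleph_one_of_countable_sections
      (E := {z | side (s (diag z.1 z.2)).1 = side (s (diag z.1 z.2)).2}) (fun u ↦ ?_) fun v ↦ ?_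
    · have hγ : Continuous fun v ↦ diag u v :=
        continuous_diag.comp (continuous_const.prodMk continuous_id)
      refine ((hc 0 0 _ hγ ?_).union (hc 1 1 _ hγ ?_)).mono ?_
      · intro t t' h h'
        rw [sideLT_zero, diag_fst_lt_iff] at h
        rw [sideLT_zero, diag_snd_lt_iff] at h'
        exact Subtype.ext (by linarith)
      · intro t t' h h'
        rw [sideLT_one, diag_fst_lt_iff] at h
        rw [sideLT_one, diag_snd_lt_iff] at h'
        exact Subtype.ext (by linarith)
      · intro v (hv : side _ = side _)
        rcases h2 (side (s (diag u v)).1) with h | h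
        exacts [Or.inl ⟨h, hv ▸ h⟩, Or.inr ⟨h, hv ▸ h⟩]
    · have hγ : Continuous fun u ↦ diag u v :=
        continuous_diag.comp (continuous_id.prodMk continuous_const)
      refine ((hc 0 1 _ hγ ?_).union (hc 1 0 _ hγ ?_)).mono ?_
      · intro t t' h h'
        rw [sideLT_zero, diag_fst_lt_iff] at h
        rw [sideLT_one, diag_snd_lt_iff] at h'
        exact Subtype.ext (by linarith)
      · intro t t' h h'
        rw [sideLT_one, diag_fst_lt_iff] at h
        rw [sideLT_zero, diag_snd_lt_iff] at h'
        exact Subtype.ext (by linarith)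
      · intro u (hu : ¬ side _ = side _)
        rcases h2 (side (s (diag u v)).1) with h | h <;>
          rcases h2 (side (s (diag u v)).2) with h' | h'
        exacts [absurd (h.trans h'.symm) hu, Or.inl ⟨h, h'⟩, Or.inr ⟨h, h'⟩,
          absurd (h.trans h'.symm) hu]
  exact (mk_Icc_real one_pos).symm.le.trans hX

end SplitInterval

/-! ### Sierpiński-type constructions along a well-order with countable initial segments -/

section Coloring

theorem Set.countable_setOf_reflTransGen {X : Type*} {r : X → X → Prop}
    (hr : ∀ x, {y | r x y}.Countable) (x : X) : {y | Relation.ReflTransGen r x y}.Countable := by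
  let T : ℕ → Set X := fun n ↦ Nat.rec {x} (fun _ S ↦ ⋃ y ∈ S, {z | r y z}) n
  have hT : ∀ n, (T n).Countable := by
    intro n
    induction n with
    | zero => exact countable_singleton x
    | succ n ih => exact ih.biUnion fun y _ ↦ hr y
  refine (countable_iUnion hT).mono fun y hy ↦ ?_
  induction hy with
  | refl => exact mem_iUnion.2 ⟨0, rfl⟩
  | tail _ hbc ih =>
    obtain ⟨n, hn⟩ := mem_iUnion.1 ih
    exact mem_iUnion.2 ⟨n + 1, mem_biUnion hn hbc⟩

theorem exists_wellOrder_countable_Iio {ι : Type*} (h : #ι ≤ ℵ₁) :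
    ∃ (_ : LinearOrder ι) (_ : WellFoundedLT ι), ∀ a : ι, (Iio a).Countable := by
  obtain ⟨_, _, ho⟩ := exists_ord_eq_type_lt ι
  refine ⟨inferInstance, inferInstance, fun a ↦ ?_⟩
  rw [← le_aleph0_iff_set_countable, ← lt_aleph_one_iff]
  exact (mk_Iio_lt a ho).trans_le h

variable {X ι : Type*} [LinearOrder ι]

lemma countable_Iic_of_countable_Iio (hι : ∀ a : ι, (Iio a).Countable) (a : ι) :
    (Iic a).Countable := by
  rw [← Iio_insert]
  exact (hι a).insert a

/-- Sierpiński's construction of a set that separates two families up to countable errors. -/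
theorem exists_separating_set (hι : ∀ a : ι, (Iio a).Countable) {A B : ι → Set X}
    (h : ∀ a b, (A a ∩ B b).Countable) :
    ∃ E : Set X, (∀ a, (A a \ E).Countable) ∧ ∀ b, (B b ∩ E).Countable := by
  -- Index order decides: `A a \ E` only involves `B b` with `b < a`, and `B b ∩ E` only `A a` with
  -- `a ≤ b`.
  refine ⟨{z | ∃ a, z ∈ A a ∧ ∀ b < a, z ∉ B b}, fun a ↦ ?_, fun b ↦ ?_⟩
  · refine ((hι a).biUnion fun b _ ↦ h a b).mono fun z ⟨hz, hzE⟩ ↦ ?_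
    have : ∃ b < a, z ∈ B b := by
      by_contra! hb
      exact hzE ⟨a, hz, hb⟩
    obtain ⟨b, hb, hzb⟩ := this
    exact mem_biUnion hb ⟨hz, hzb⟩
  · refine ((countable_Iic_of_countable_Iio hι b).biUnion fun a _ ↦ h a b).mono ?_
    rintro z ⟨hz, a, hza, ha⟩
    exact mem_biUnion (not_lt.1 fun hba ↦ ha b hba hz) ⟨hza, hz⟩

/-- For `ℵ₁` many relations with countable sections in both variables, the points can be
distributed over countable levels such that each relation connects points of the same level, up to
countably many exceptions. -/
theorem exists_level [WellFoundedLT ι] (hι : ∀ a : ι, (Iio a).Countable)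
    {D : ι → Set (X × X)} (hD : ∀ a x, {y | (x, y) ∈ D a}.Countable)
    (hD' : ∀ a y, {x | (x, y) ∈ D a}.Countable) {e : ι → X} (he : Function.Surjective e) :
    ∃ lev : X → ι, (∀ d, {x | lev x = d}.Countable) ∧
      ∀ a, {z ∈ D a | lev z.1 ≠ lev z.2}.Countable := by
  let r : ι → X → X → Prop := fun d x y ↦ ∃ a < d, (x, y) ∈ D a ∨ (y, x) ∈ D a
  -- `C d` is the component of `e d` under the relations before `d`; the level is the first `d`
  -- whose component contains the point. If `D a` links two points of levels above `a`, each lies in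
  -- the other's component, so the levels agree.
  let C : ι → Set X := fun d ↦ {x | Relation.ReflTransGen (r d) (e d) x}
  have hC (d : ι) : (C d).Countable := by
    refine countable_setOf_reflTransGen (fun x ↦ ?_) _
    refine ((hι d).biUnion fun a _ ↦ (hD a x).union (hD' a x)).mono ?_
    rintro y ⟨a, ha, h⟩
    exact mem_biUnion ha h
  have hne (x : X) : {d | x ∈ C d}.Nonempty := by
    obtain ⟨d, rfl⟩ := he x
    exact ⟨d, .refl⟩
  let lev : X → ι := fun x ↦ WellFounded.min wellFounded_lt {d | x ∈ C d} (hne x)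
  have hlev (x : X) : x ∈ C (lev x) := WellFounded.min_mem wellFounded_lt _ (hne x)
  have hle {x : X} {d : ι} (h : x ∈ C d) : lev x ≤ d :=
    not_lt.1 (WellFounded.not_lt_min wellFounded_lt {d | x ∈ C d} h)
  have hlevc (d : ι) : {x | lev x = d}.Countable := (hC d).mono fun x hx ↦ by
    rw [← show lev x = d from hx]
    exact hlev x
  refine ⟨lev, hlevc, fun a ↦ ?_⟩
  have hlow : {x | lev x ≤ a}.Countable :=
    ((countable_Iic_of_countable_Iio hι a).biUnion fun d _ ↦ hlevc d).mono
      fun x hx ↦ mem_biUnion (show lev x ∈ Iic a from hx) rfl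
  refine ((hlow.biUnion fun x _ ↦ (hD a x).image fun y ↦ (x, y)).union
    (hlow.biUnion fun y _ ↦ (hD' a y).image fun x ↦ (x, y))).mono ?_
  rintro ⟨x, y⟩ ⟨hz, hxy⟩
  by_cases hx : lev x ≤ a
  · exact Or.inl (mem_biUnion hx ⟨y, hz, rfl⟩)
  by_cases hy : lev y ≤ a
  · exact Or.inr (mem_biUnion hy ⟨x, hz, rfl⟩)
  · refine absurd (le_antisymm (hle ?_) (hle ?_)) hxy
    · exact (hlev y).tail ⟨a, not_le.1 hy, Or.inr hz⟩
    · exact (hlev x).tail ⟨a, not_le.1 hx, Or.inl hz⟩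

/-- Two families of relations, the first one almost disjoint from the second one, admit two
`0`-`1`-valued functions that agree almost everywhere on the members of the first family, disagree
almost everywhere on the members of the second one, and each of which has only finitely many
zeros in one of the variables. -/
theorem exists_coloring [WellFoundedLT ι] (hι : ∀ a : ι, (Iio a).Countable)
    {A D : ι → Set (X × X)} (hAD : ∀ a b, (A a ∩ D b).Countable)
    (hD : ∀ a x, {y | (x, y) ∈ D a}.Countable)
    (hD' : ∀ a y, {x | (x, y) ∈ D a}.Countable) {e : ι → X} (he : Function.Surjective e) :
    ∃ f g : X × X → Fin 2, (∀ a, {z ∈ A a | f z ≠ g z}.Countable) ∧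
      (∀ a, {z ∈ D a | f z = g z}.Countable) ∧
      (∀ x, {y | f (x, y) = 0}.Finite) ∧ ∀ y, {x | g (x, y) = 0}.Finite := by
  classical
  obtain ⟨E, hAE, hDE⟩ := exists_separating_set hι hAD
  obtain ⟨lev, hlev, hDlev⟩ := exists_level hι hD hD' he
  choose n hn using fun d ↦ countable_iff_exists_injOn.1 (hlev d)
  have hfin (d : ι) (k : ℕ) : {x | lev x = d ∧ n d x ≤ k}.Finite := by
    refine Set.Finite.of_finite_image (f := n d) ((finite_Iic k).subset ?_)
      ((hn d).mono fun x hx ↦ hx.1)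
    rintro _ ⟨x, hx, rfl⟩
    exact hx.2
  -- On `N` exactly one of `f`, `g` vanishes, chosen by comparing ranks in the enumeration of the
  -- common level; off `N` both are `1`. A zero forces the free variable to have rank bounded by the
  -- fixed one.
  let N : X × X → Prop := fun z ↦ lev z.1 = lev z.2 ∧ z ∉ E
  let L : X × X → Prop := fun z ↦ n (lev z.1) z.1 < n (lev z.1) z.2
  refine ⟨fun z ↦ if N z ∧ ¬ L z then 0 else 1, fun z ↦ if N z ∧ L z then 0 else 1,
    fun a ↦ (hAE a).mono ?_, fun a ↦ ((hDlev a).union (hDE a)).mono ?_, fun x ↦ ?_, fun y ↦ ?_⟩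
  · rintro z ⟨hz, hne⟩
    refine ⟨hz, fun hzE ↦ hne ?_⟩
    simp [N, hzE]
  · rintro z ⟨hz, heq⟩
    by_cases hzE : z ∈ E
    · exact Or.inr ⟨hz, hzE⟩
    refine Or.inl ⟨hz, fun hl ↦ ?_⟩
    by_cases hL : L z <;> simp [N, hzE, hl, hL] at heq
  · refine (hfin (lev x) (n (lev x) x)).subset fun y hy ↦ ?_
    simp only [mem_ofPred_eq, ite_eq_left_iff, one_ne_zero, imp_false, not_not] at hy
    exact ⟨hy.1.1.symm, not_lt.1 hy.2⟩
  · refine (hfin (lev y) (n (lev y) y)).subset fun x hx ↦ ?_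
    simp only [mem_ofPred_eq, ite_eq_left_iff, one_ne_zero, imp_false, not_not] at hx
    obtain ⟨⟨hl, -⟩, hL⟩ := hx
    have hl : lev x = lev y := hl
    have hL : n (lev x) x < n (lev x) y := hL
    rw [hl] at hL
    exact ⟨hl, hL.le⟩

end Coloring

/-! ### Closure properties of `F_σ` sets -/

section Fsigma

variable {X Y : Type*} [TopologicalSpace X] [TopologicalSpace Y]

lemma IsClosed.isFsigma {S : Set X} (h : IsClosed S) : IsFsigma S :=
  ⟨fun _ ↦ S, fun _ ↦ h, (iUnion_const S).symm⟩

lemma IsFsigma.iUnion {κ : Type*} [Countable κ] {S : κ → Set X} (h : ∀ k, IsFsigma (S k)) :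
    IsFsigma (⋃ k, S k) := by
  rcases isEmpty_or_nonempty κ with hκ | hκ
  · rw [iUnion_of_empty]
    exact isClosed_empty.isFsigma
  choose F hF hS using h
  obtain ⟨e, he⟩ := exists_surjective_nat (κ × ℕ)
  refine ⟨fun n ↦ F (e n).1 (e n).2, fun n ↦ hF _ _, ?_⟩
  rw [he.iUnion_comp fun p : κ × ℕ ↦ F p.1 p.2, iUnion_prod']
  exact iUnion_congr hS

lemma IsFsigma.biUnion {κ : Type*} {I : Set κ} (hI : I.Countable) {S : κ → Set X}
    (h : ∀ k ∈ I, IsFsigma (S k)) : IsFsigma (⋃ k ∈ I, S k) := by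
  have := hI.to_subtype
  rw [biUnion_eq_iUnion]
  exact IsFsigma.iUnion fun k ↦ h k k.2

lemma IsFsigma.union {S T : Set X} (hS : IsFsigma S) (hT : IsFsigma T) : IsFsigma (S ∪ T) := by
  rw [union_eq_iUnion]
  exact IsFsigma.iUnion fun b ↦ by cases b <;> assumption

lemma Set.Countable.isFsigma [T1Space X] {S : Set X} (hS : S.Countable) : IsFsigma S := by
  rw [← biUnion_of_singleton S]
  exact IsFsigma.biUnion hS fun x _ ↦ isClosed_singleton.isFsigma

lemma IsFsigma.image {S : Set X} (hS : IsFsigma S) {f : X → Y} (hf : IsClosedMap f) :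
    IsFsigma (f '' S) := by
  obtain ⟨F, hF, rfl⟩ := hS
  exact ⟨fun n ↦ f '' F n, fun n ↦ hf _ (hF n), image_iUnion⟩

lemma IsFsigma.measurableSet_borel {S : Set X} (hS : IsFsigma S) :
    @MeasurableSet X (borel X) S := by
  obtain ⟨F, hF, rfl⟩ := hS
  borelize X
  exact MeasurableSet.iUnion fun n ↦ (hF n).measurableSet

lemma IsOpen.isFsigma {X : Type*} [PseudoEMetricSpace X] {S : Set X} (h : IsOpen S) :
    IsFsigma S := by
  obtain ⟨F, hF, -, hS, -⟩ := h.exists_iUnion_isClosed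
  exact ⟨F, hF, hS.symm⟩

end Fsigma

/-! ### Quadrant-free sets and monotone curves -/

section QuadrantFree

/-- No point of `A` lies in the open quadrant of type `(i, j)` of another point of `A`. -/
def QuadrantFree (i j : Fin 2) (A : Set (unitInterval × unitInterval)) : Prop :=
  ∀ z ∈ A, ∀ w ∈ A, ¬ (SideLT i (z.1 : ℝ) w.1 ∧ SideLT j (z.2 : ℝ) w.2)

variable {i j : Fin 2} {A : Set (unitInterval × unitInterval)}

/-- The forbidden relation is open in the pair, so a bad pair in the closure could be moved into
`A`. -/
lemma quadrantFree_closure (h : QuadrantFree i j A) : QuadrantFree i j (closure A) := by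
  intro z hz w hw hzw
  let O : Set ((unitInterval × unitInterval) × (unitInterval × unitInterval)) :=
    {p | SideLT i (p.1.1 : ℝ) p.2.1 ∧ SideLT j (p.1.2 : ℝ) p.2.2}
  have hO : IsOpen O :=
    (isOpen_setOf_sideLT i (by fun_prop) (by fun_prop)).inter
      (isOpen_setOf_sideLT j (by fun_prop) (by fun_prop))
  have hmem : (z, w) ∈ closure (A ×ˢ A) := by
    rw [closure_prod_eq]
    exact ⟨hz, hw⟩
  obtain ⟨p, hpO, hpA⟩ := mem_closure_iff.1 hmem O hO hzw
  exact h _ hpA.1 _ hpA.2 hpO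

lemma QuadrantFree.swap (h : QuadrantFree i j A) : QuadrantFree j i (Prod.swap ⁻¹' A) :=
  fun _ hz _ hw hzw ↦ h _ hz _ hw hzw.symm

/-- Only countably many vertical sections have more than one point. -/
lemma QuadrantFree.countable_setOf_two_points (h : QuadrantFree i j A) :
    {x | ∃ y y', y ≠ y' ∧ (x, y) ∈ A ∧ (x, y') ∈ A}.Countable := by
  let S : ℚ → Set unitInterval := fun q ↦
    {x | ∃ y y' : unitInterval, (x, y) ∈ A ∧ (x, y') ∈ A ∧ SideLT j (y : ℝ) q ∧
      SideLT j (q : ℝ) y'}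
  -- If two sections both straddle `q`, the first half of one and the second half of the other form
  -- a forbidden pair.
  have hS (q : ℚ) : (S q).Subsingleton := by
    rintro x ⟨y₁, y₁', h₁, h₁', hq₁, hq₁'⟩ x' ⟨y₂, y₂', h₂, h₂', hq₂, hq₂'⟩
    by_contra hne
    rcases sideLT_or_sideLT_of_ne i (fun he ↦ hne (Subtype.ext he) : (x : ℝ) ≠ x') with hx | hx
    · exact h _ h₁ _ h₂' ⟨hx, hq₁.trans hq₂'⟩
    · exact h _ h₂ _ h₁' ⟨hx, hq₂.trans hq₁'⟩
  refine (countable_iUnion fun q ↦ (hS q).countable).mono ?_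
  rintro x ⟨y, y', hne, hy, hy'⟩
  rcases sideLT_or_sideLT_of_ne j (fun he ↦ hne (Subtype.ext he) : (y : ℝ) ≠ y') with hlt | hlt <;>
    obtain ⟨q, hq, hq'⟩ := exists_rat_sideLT j hlt
  exacts [mem_iUnion.2 ⟨q, y, y', hy, hy', hq, hq'⟩, mem_iUnion.2 ⟨q, y', y, hy', hy, hq, hq'⟩]

/-- The points of `C` that share no coordinate with another point of `C`. -/
def strictPart (C : Set (unitInterval × unitInterval)) : Set (unitInterval × unitInterval) :=
  {z ∈ C | ∀ w ∈ C, w ≠ z → w.1 ≠ z.1 ∧ w.2 ≠ z.2}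

/-- The strictly monotone curve coded by a sequence `q`; it is empty if the closure of `q` is not
free of quadrants of type `(i, j)`. -/
def codedCurve (i j : Fin 2) (q : ℕ → unitInterval × unitInterval) :
    Set (unitInterval × unitInterval) :=
  {z ∈ strictPart (closure (range q)) | QuadrantFree i j (closure (range q))}

/-- By separability the closure of `A` is coded by a sequence; its points sharing a coordinate with
another one lie on countably many lines. -/
lemma QuadrantFree.exists_codedCurve (h : QuadrantFree i j A) :
    ∃ (q : ℕ → unitInterval × unitInterval) (X Y : Set unitInterval), X.Countable ∧ Y.Countable ∧
      ∀ z ∈ A, z ∈ codedCurve i j q ∨ z.1 ∈ X ∨ z.2 ∈ Y := by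
  rcases A.eq_empty_or_nonempty with rfl | hA
  · exact ⟨fun _ ↦ 0, ∅, ∅, countable_empty, countable_empty, by simp⟩
  have := hA.to_subtype
  let q : ℕ → unitInterval × unitInterval := fun n ↦ (TopologicalSpace.denseSeq A n : A)
  have hq : closure (range q) = closure A := by
    refine (closure_mono (range_subset_iff.2 fun n ↦ Subtype.coe_prop _)).antisymm ?_
    refine closure_minimal (fun z hz ↦ ?_) isClosed_closure
    have hd := TopologicalSpace.denseRange_denseSeq A ⟨z, hz⟩
    have := map_mem_closure continuous_subtype_val hd
      (t := range q) (by rintro _ ⟨n, rfl⟩; exact ⟨n, rfl⟩)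
    exact this
  refine ⟨q, _, _, (quadrantFree_closure h).countable_setOf_two_points,
    (quadrantFree_closure h).swap.countable_setOf_two_points, fun z hz ↦ ?_⟩
  by_contra! hz'
  obtain ⟨h₁, h₂, h₃⟩ := hz'
  refine h₁ ⟨⟨hq ▸ subset_closure hz, fun w hw hne ↦ ⟨fun he ↦ h₂ ?_, fun he ↦ h₃ ?_⟩⟩,
    hq ▸ quadrantFree_closure h⟩
  · exact ⟨z.2, w.2, fun h ↦ hne (Prod.ext he h.symm), subset_closure hz,
      show (z.1, w.2) ∈ closure A from he ▸ hq ▸ hw⟩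
  · exact ⟨z.1, w.1, fun h ↦ hne (Prod.ext h.symm he), subset_closure hz,
      show (w.1, z.2) ∈ closure A from he ▸ hq ▸ hw⟩

lemma subsingleton_setOf_mk_mem_codedCurve (q : ℕ → unitInterval × unitInterval)
    (x : unitInterval) : {y | (x, y) ∈ codedCurve i j q}.Subsingleton := by
  intro y hy y' hy'
  by_contra hne
  exact (hy.1.2 _ hy'.1.1 fun h ↦ hne (congrArg Prod.snd h).symm).1 rfl

lemma subsingleton_setOf_mk_mem_codedCurve' (q : ℕ → unitInterval × unitInterval)
    (y : unitInterval) : {x | (x, y) ∈ codedCurve i j q}.Subsingleton := by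
  intro x hx x' hx'
  by_contra hne
  exact (hx.1.2 _ hx'.1.1 fun h ↦ hne (congrArg Prod.fst h).symm).2 rfl

/-- One curve is strictly increasing, the other strictly decreasing. -/
lemma subsingleton_codedCurve_inter (q q' : ℕ → unitInterval × unitInterval) :
    (codedCurve 0 1 q ∩ codedCurve 1 1 q').Subsingleton := by
  rintro z ⟨hz, hz'⟩ w ⟨hw, hw'⟩
  by_contra hne
  obtain ⟨h₁, h₂⟩ := hz.1.2 w hw.1.1 (Ne.symm hne)
  have hi := hz.2 z hz.1.1 w hw.1.1
  have hi' := hz.2 w hw.1.1 z hz.1.1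
  have hd := hz'.2 z hz'.1.1 w hw'.1.1
  have hd' := hz'.2 w hw'.1.1 z hz'.1.1
  simp only [sideLT_zero, sideLT_one, Subtype.coe_lt_coe, not_and] at hi hi' hd hd'
  rcases h₁.lt_or_gt with h₁ | h₁ <;> rcases h₂.lt_or_gt with h₂ | h₂
  exacts [hd' h₁ h₂, hi h₁ h₂, hi' h₁ h₂, hd h₁ h₂]

lemma quadrantFree_zero_zero : QuadrantFree 0 0 A ↔ QuadrantFree 1 1 A := by
  simp only [QuadrantFree, sideLT_zero, sideLT_one]
  exact ⟨fun h z hz w hw ↦ h w hw z hz, fun h z hz w hw ↦ h w hw z hz⟩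

lemma quadrantFree_one_zero : QuadrantFree 1 0 A ↔ QuadrantFree 0 1 A := by
  simp only [QuadrantFree, sideLT_zero, sideLT_one]
  exact ⟨fun h z hz w hw ↦ h w hw z hz, fun h z hz w hw ↦ h w hw z hz⟩

end QuadrantFree

theorem exists_coloring_unitSquare (hCH : aleph.{0} 1 = continuum.{0}) :
    ∃ f g : unitInterval × unitInterval → Fin 2,
      (∀ i j q, {z ∈ codedCurve i j q | f z = i ∧ g z = j}.Countable) ∧
      (∀ x, {y | f (x, y) = 0}.Finite) ∧ ∀ y, {x | g (x, y) = 0}.Finite := by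
  have hI : #unitInterval = 𝔠 := mk_Icc_real one_pos
  have hcard : #(ℕ → unitInterval × unitInterval) ≤ ℵ₁ := by
    rw [hCH]
    simp [hI]
  obtain ⟨_, _, hι⟩ := exists_wellOrder_countable_Iio hcard
  -- Equal sides on increasing curves exclude types `(0, 1)` and `(1, 0)`; different sides on
  -- decreasing curves exclude `(0, 0)` and `(1, 1)`.
  obtain ⟨f, g, hA, hD, hf, hg⟩ := exists_coloring hι (A := codedCurve 0 1) (D := codedCurve 1 1)
    (fun a b ↦ (subsingleton_codedCurve_inter a b).countable)
    (fun a x ↦ (subsingleton_setOf_mk_mem_codedCurve a x).countable)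
    (fun a y ↦ (subsingleton_setOf_mk_mem_codedCurve' a y).countable)
    (e := fun q ↦ (q 0).1) (fun x ↦ ⟨fun _ ↦ (x, x), rfl⟩)
  refine ⟨f, g, fun i j q ↦ ?_, hf, hg⟩
  have h2 : ∀ i : Fin 2, i = 0 ∨ i = 1 := by decide
  rcases h2 i with rfl | rfl <;> rcases h2 j with rfl | rfl
  · refine (hD q).mono ?_
    rintro z ⟨hz, h₁, h₂⟩
    exact ⟨⟨hz.1, quadrantFree_zero_zero.1 hz.2⟩, h₁.trans h₂.symm⟩
  · refine (hA q).mono ?_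
    rintro z ⟨hz, h₁, h₂⟩
    exact ⟨hz, by simp [h₁, h₂]⟩
  · refine (hA q).mono ?_
    rintro z ⟨hz, h₁, h₂⟩
    exact ⟨⟨hz.1, quadrantFree_one_zero.1 hz.2⟩, by simp [h₁, h₂]⟩
  · refine (hD q).mono ?_
    rintro z ⟨hz, h₁, h₂⟩
    exact ⟨hz, h₁.trans h₂.symm⟩

/-! ### The `F_σ`-measurable selection under CH -/

namespace SplitInterval

/-- One-dimensional case, for any choice of sides: two non-interior points with the same side and
rational bound are impossible, since the interval at one would contain the other. So the preimage is
open up to a countable set. -/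
lemma isFsigma_setOf_mk_mem {V : Set SplitInterval} (hV : IsOpen V) (t : unitInterval → Fin 2)
    {K : Set unitInterval} (hK : K.Finite) : IsFsigma {y | y ∉ K ∧ mk y (t y) ∈ V} := by
  let S : Set unitInterval := {y | mk y (t y) ∈ V}
  let N : Fin 2 × ℚ → Set unitInterval := fun p ↦
    {y | y ∉ interior S ∧ SideLT p.1 (y : ℝ) p.2 ∧
      ∀ w : unitInterval, SideLT p.1 (y : ℝ) w → SideLT p.1 (w : ℝ) p.2 → w ∈ S}
  have hlt {p : Fin 2 × ℚ} {y y' : unitInterval} (hy : y ∈ N p) (hy' : y' ∈ N p) :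
      ¬ SideLT p.1 (y : ℝ) y' := by
    intro h
    have hO : IsOpen {w : unitInterval | SideLT p.1 (y : ℝ) w ∧ SideLT p.1 (w : ℝ) p.2} :=
      (isOpen_setOf_sideLT _ (by fun_prop) (by fun_prop)).inter
        (isOpen_setOf_sideLT _ (by fun_prop) (by fun_prop))
    exact hy'.1 (interior_maximal (fun w hw ↦ hy.2.2 w hw.1 hw.2) hO ⟨h, hy'.2.1⟩)
  have hN (p : Fin 2 × ℚ) : (N p).Subsingleton := by
    intro y hy y' hy'
    by_contra hne
    rcases sideLT_or_sideLT_of_ne p.1 (fun he ↦ hne (Subtype.ext he) : (y : ℝ) ≠ y') with h | h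
    exacts [hlt hy hy' h, hlt hy' hy h]
  have hc : (S \ interior S).Countable := by
    refine (countable_iUnion fun p ↦ (hN p).countable).mono fun y hy ↦ ?_
    obtain ⟨c, hc, hw⟩ := exists_rat_forall_mk_mem hV hy.1
    exact mem_iUnion.2 ⟨(t y, c), hy.2, hc, fun w h h' ↦ hw w h h' _⟩
  have heq : {y | y ∉ K ∧ mk y (t y) ∈ V} = (interior S \ K) ∪ ((S \ interior S) \ K) := by
    rw [← union_sdiff_distrib, union_sdiff_cancel interior_subset]
    ext y
    exact and_comm
  rw [heq]
  exact (isOpen_interior.sdiff hK.isClosed).isFsigma.union (hc.mono sdiff_subset).isFsigma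

variable (f g : unitInterval × unitInterval → Fin 2)

/-- The selection of `projSqInv` with prescribed sides. -/
def selectionOf (z : unitInterval × unitInterval) : SplitInterval × SplitInterval :=
  (mk z.1 (f z), mk z.2 (g z))

lemma isSelection_selectionOf : IsSelection (selectionOf f g) projSqInv := fun _ ↦ rfl

variable {f g} {U : Set (SplitInterval × SplitInterval)}

lemma isFsigma_preimage_inter_vertical (hU : IsOpen U) {x : unitInterval}
    (hf : {y | f (x, y) = 0}.Finite) :
    IsFsigma (selectionOf f g ⁻¹' U ∩ {z | z.1 = x}) := by
  -- Off finitely many points of the line the first coordinate of the selection is constantly `mk x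
  -- 1`.
  have hV : IsOpen {b | (mk x 1, b) ∈ U} := hU.preimage (by fun_prop)
  have h := ((isFsigma_setOf_mk_mem hV (fun y ↦ g (x, y)) hf).union
    (hf.countable.mono
      (inter_subset_left (t := {y | selectionOf f g (x, y) ∈ U}))).isFsigma).image
    (Continuous.isClosedMap (f := fun y : unitInterval ↦ (x, y)) (by fun_prop))
  convert h using 1
  ext ⟨x', y⟩
  have h2 : ∀ i : Fin 2, i = 0 ∨ i = 1 := by decide
  constructor
  · rintro ⟨hz, rfl : x' = x⟩
    refine ⟨y, ?_, rfl⟩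
    rcases h2 (f (x', y)) with h0 | h1
    · exact Or.inr ⟨h0, hz⟩
    · refine Or.inl ⟨by simp [h1], ?_⟩
      simpa [selectionOf, h1] using hz
  · rintro ⟨y', hy', he⟩
    obtain ⟨rfl, rfl⟩ := Prod.mk.inj he
    refine ⟨?_, rfl⟩
    rcases hy' with ⟨h0, hy'⟩ | hy'
    · have h1 := (h2 (f (x, y'))).resolve_left h0
      simpa [selectionOf, h1] using hy'
    · exact hy'.2

lemma isFsigma_preimage_inter_horizontal (hU : IsOpen U) {y : unitInterval}
    (hg : {x | g (x, y) = 0}.Finite) :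
    IsFsigma (selectionOf f g ⁻¹' U ∩ {z | z.2 = y}) := by
  have hU' : IsOpen (Prod.swap ⁻¹' U) := hU.preimage continuous_swap
  have h := (isFsigma_preimage_inter_vertical (f := g ∘ Prod.swap) (g := f ∘ Prod.swap) hU'
    (x := y) hg).image (Homeomorph.prodComm unitInterval unitInterval).isClosedMap
  convert h using 1
  ext z
  constructor
  · exact fun hz ↦ ⟨z.swap, hz, rfl⟩
  · rintro ⟨w, hw, rfl⟩
    exact hw

/-- The preimage of an open set is open up to a countable set and countably many lines. -/
lemma exists_countable_cover_preimage_diff_interior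
    (hfg : ∀ i j q, {z ∈ codedCurve i j q | f z = i ∧ g z = j}.Countable) (hU : IsOpen U) :
    ∃ (K : Set (unitInterval × unitInterval)) (X Y : Set unitInterval),
      K.Countable ∧ X.Countable ∧ Y.Countable ∧
      ∀ z ∈ selectionOf f g ⁻¹' U \ interior (selectionOf f g ⁻¹' U),
        z ∈ K ∨ z.1 ∈ X ∨ z.2 ∈ Y := by
  set S := selectionOf f g ⁻¹' U
  let N : (Fin 2 × Fin 2) × (ℚ × ℚ) → Set (unitInterval × unitInterval) := fun p ↦
    {z | z ∉ interior S ∧ (SideLT p.1.1 (z.1 : ℝ) p.2.1 ∧ SideLT p.1.2 (z.2 : ℝ) p.2.2) ∧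
      (f z = p.1.1 ∧ g z = p.1.2) ∧
      ∀ w : unitInterval × unitInterval,
        SideLT p.1.1 (z.1 : ℝ) w.1 → SideLT p.1.1 (w.1 : ℝ) p.2.1 →
        SideLT p.1.2 (z.2 : ℝ) w.2 → SideLT p.1.2 (w.2 : ℝ) p.2.2 → w ∈ S}
  -- A point in the quadrant of another would lie in an open rectangle contained in `S`, hence in
  -- the interior.
  have hN (p) : QuadrantFree p.1.1 p.1.2 (N p) := by
    rintro z hz w hw ⟨h₁, h₂⟩
    have hO : IsOpen {w : unitInterval × unitInterval |
        (SideLT p.1.1 (z.1 : ℝ) w.1 ∧ SideLT p.1.1 (w.1 : ℝ) p.2.1) ∧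
        SideLT p.1.2 (z.2 : ℝ) w.2 ∧ SideLT p.1.2 (w.2 : ℝ) p.2.2} :=
      ((isOpen_setOf_sideLT _ (by fun_prop) (by fun_prop)).inter
        (isOpen_setOf_sideLT _ (by fun_prop) (by fun_prop))).inter
      ((isOpen_setOf_sideLT _ (by fun_prop) (by fun_prop)).inter
        (isOpen_setOf_sideLT _ (by fun_prop) (by fun_prop)))
    exact hw.1 (interior_maximal
      (fun v hv ↦ hz.2.2.2 v hv.1.1 hv.1.2 hv.2.1 hv.2.2) hO ⟨⟨h₁, hw.2.1.1⟩, h₂, hw.2.1.2⟩)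
  choose q X Y hX hY hcover using fun p ↦ (hN p).exists_codedCurve
  refine ⟨⋃ p : (Fin 2 × Fin 2) × (ℚ × ℚ),
      {z ∈ codedCurve p.1.1 p.1.2 (q p) | f z = p.1.1 ∧ g z = p.1.2}, ⋃ p, X p, ⋃ p, Y p,
    countable_iUnion fun p ↦ hfg _ _ _, countable_iUnion hX, countable_iUnion hY, ?_⟩
  rintro z ⟨hz, hzi⟩
  obtain ⟨V, W, hV, hW, hzV, hzW, hVW⟩ := isOpen_prod_iff.1 hU _ _ hz
  obtain ⟨a, ha, haw⟩ := exists_rat_forall_mk_mem hV hzV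
  obtain ⟨b, hb, hbw⟩ := exists_rat_forall_mk_mem hW hzW
  have hzN : z ∈ N ((f z, g z), (a, b)) := ⟨hzi, ⟨ha, hb⟩, ⟨rfl, rfl⟩, fun w h₁ h₁' h₂ h₂' ↦
    hVW ⟨haw _ h₁ h₁' _, hbw _ h₂ h₂' _⟩⟩
  rcases hcover _ z hzN with h | h | h
  · exact Or.inl (mem_iUnion.2 ⟨_, h, rfl, rfl⟩)
  · exact Or.inr (Or.inl (mem_iUnion.2 ⟨_, h⟩))
  · exact Or.inr (Or.inr (mem_iUnion.2 ⟨_, h⟩))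

theorem exists_isFsigmaMeasurable_selection (hCH : aleph.{0} 1 = continuum.{0}) :
    ∃ s : unitInterval × unitInterval → SplitInterval × SplitInterval,
      IsSelection s projSqInv ∧ IsFsigmaMeasurable s := by
  obtain ⟨f, g, hfg, hf, hg⟩ := exists_coloring_unitSquare hCH
  refine ⟨selectionOf f g, isSelection_selectionOf f g, fun U hU ↦ ?_⟩
  obtain ⟨K, X, Y, hK, hX, hY, hcover⟩ := exists_countable_cover_preimage_diff_interior hfg hU
  set S := selectionOf f g ⁻¹' U
  have heq : S = interior S ∪ (K ∩ S) ∪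
      ((⋃ x ∈ X, S ∩ {z | z.1 = x}) ∪ ⋃ y ∈ Y, S ∩ {z | z.2 = y}) := by
    refine Subset.antisymm (fun z hz ↦ ?_) ?_
    · by_cases hzi : z ∈ interior S
      · exact Or.inl (Or.inl hzi)
      rcases hcover z ⟨hz, hzi⟩ with h | h | h
      · exact Or.inl (Or.inr ⟨h, hz⟩)
      · exact Or.inr (Or.inl (mem_biUnion h ⟨hz, rfl⟩))
      · exact Or.inr (Or.inr (mem_biUnion h ⟨hz, rfl⟩))
    · exact union_subset (union_subset interior_subset inter_subset_right)
        (union_subset (iUnion₂_subset fun x _ ↦ inter_subset_left)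
          (iUnion₂_subset fun y _ ↦ inter_subset_left))
  rw [heq]
  exact (isOpen_interior.isFsigma.union (hK.mono inter_subset_left).isFsigma).union
    ((IsFsigma.biUnion hX fun x _ ↦ isFsigma_preimage_inter_vertical hU (hf x)).union
      (IsFsigma.biUnion hY fun y _ ↦ isFsigma_preimage_inter_horizontal hU (hg y)))

end SplitInterval

theorem theorem3 :
    IsUsco SplitInterval.projSqInv ∧
    List.TFAE [
      ∃ s : unitInterval × unitInterval → SplitInterval × SplitInterval,
        IsSelection s SplitInterval.projSqInv ∧ IsBorelMeasurable s,
      ∃ s : unitInterval × unitInterval → SplitInterval × SplitInterval,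
        IsSelection s SplitInterval.projSqInv ∧ IsFsigmaMeasurable s,
      Cardinal.aleph.{0} 1 = Cardinal.continuum.{0}] := by
  refine ⟨SplitInterval.isUsco_projSqInv, ?_⟩
  tfae_have 1 → 3 := fun ⟨_, hs, hb⟩ ↦
    SplitInterval.aleph_one_eq_continuum_of_borel_selection hs hb
  tfae_have 3 → 2 := SplitInterval.exists_isFsigmaMeasurable_selection
  tfae_have 2 → 1 := fun ⟨s, hs, hF⟩ ↦ ⟨s, hs, fun U hU ↦ (hF U hU).measurableSet_borel⟩
  tfae_finish
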